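/- Let $G$ be a finite group and let $T$ be a nonzero $G$-Tambara functor: commutative rings $T(G/H)$ for $H\le G$, not all zero, with restrictions $r^H_K$ (ring homomorphisms), transfers $t^H_K$ (additive) and norms $N^H_K$ (multiplicative) for $K\le H$, and conjugations $c_g\colon T(G/H)\xrightarrow{\cong} T(G/gHg^{-1})$ (ring isomorphisms), subject to the usual axioms: functoriality, compatibility with conjugation, the additive and multiplicative double coset formulas, Frobenius reciprocity, and Tambara reciprocity for norms of sums and of transfers. A Tambara ideal $I\trianglelefteq T$ is a family of ideals $I(G/H)\subseteq T(G/H)$ closed under restrictions, transfers and norms and satisfying $c_g(I(G/H))=I(G/gHg^{-1})$; inclusion of Tambara ideals is levelwise, and the product $IJ$ is the smallest Tambara ideal containing $I(G/H)\cdot J(G/H)$ for all $H\le G$. A Tambara ideal $P$ is a Nakaoka prime if $1\notin P(G/G)$ and, for all Tambara ideals $I,J$, $IJ\subseteq P$ implies $I\subseteq P$ or $J\subseteq P$. The Nakaoka spectrum $\mathrm{Spec}_{\mathrm{Nak}}(T)$ is the set of Nakaoka primes of $T$, with the topology for which the sets $V_H(x)=\{P \mid x\in P(G/H)\}$, $H\le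 G$, $x\in T(G/H)$, form a subbasis of closed sets. The nilradical $\sqrt{0}$ is the Tambara ideal with $$\sqrt{0}\,(G/H)=\{x\in T(G/H)\mid \langle x\rangle^n=0\text{ for some } n\ge 1\},$$ where $\langle x\rangle$ is the smallest Tambara ideal containing $x$ and $\langle x\rangle^n$ is its $n$-fold product. Then $\sqrt{0}$ is a Nakaoka prime if and only if $\mathrm{Spec}_{\mathrm{Nak}}(T)$ is irreducible (that is, nonempty and such that any two nonempty open subsets intersect). -/

import Mathlib

open scoped Pointwise

/-- A finite set `R` contains exactly one representative of each equivalence class of `s`. -/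
def IsTransversal {α : Type*} (s : Setoid α) (R : Finset α) : Prop :=
  ∀ a, ∃! b, b ∈ R ∧ s a b

theorem IsTransversal.exists {α : Type*} [Finite α] (s : Setoid α) :
    ∃ R : Finset α, IsTransversal s R := by
  refine ⟨(Set.range (Quotient.out : Quotient s → α)).toFinite.toFinset, fun a => ?_⟩
  refine ⟨(Quotient.mk s a).out, ⟨by simp, s.symm (Quotient.mk_out a)⟩, ?_⟩
  rintro b ⟨hb, hab⟩
  obtain ⟨q, rfl⟩ : b ∈ Set.range (Quotient.out : Quotient s → α) := by simpa using hb
  have : Quotient.mk s a = q := by rw [← Quotient.out_eq q]; exact Quotient.sound hab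
  rw [this]

/-- `Γ ⊆ L` is a set of representatives of the double cosets `A \ L / H`, where `A` is a
subgroup of `L` and `H ∩ L` is used for `H` (so that `H` itself is used when `H ≤ L`). -/
def IsDoubleCosetTransversal {G : Type*} [Group G] {L : Subgroup G} (A : Subgroup L)
    (H : Subgroup G) (Γ : Finset L) : Prop :=
  IsTransversal (DoubleCoset.setoid (A : Set L) (H.subgroupOf L : Set L)) Γ

/-- The set of all functions `L / H → {a, b}`, the two values being labelled by `true` and
`false`. The group `L` acts by `(g • f) y = f (g⁻¹ • y)`. -/
def TwoColoring {G : Type*} [Group G] (H L : Subgroup G) : Type _ :=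
  (L ⧸ H.subgroupOf L) → Bool

instance TwoColoring.instMulAction {G : Type*} [Group G] (H L : Subgroup G) :
    MulAction L (TwoColoring H L) :=
  arrowAction

theorem subgroupOf_le_subgroupOf {G : Type*} [Group G] {K H : Subgroup G} (L : Subgroup G)
    (hKH : K ≤ H) : K.subgroupOf L ≤ H.subgroupOf L :=
  Subgroup.comap_mono hKH

/-- The set of all sections of the projection `L / K → L / H`, for `K ≤ H ≤ L`. -/
def CosetSection {G : Type*} [Group G] {K H : Subgroup G} (L : Subgroup G) (hKH : K ≤ H) :
    Type _ :=
  {s : (L ⧸ H.subgroupOf L) → (L ⧸ K.subgroupOf L) //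
    ∀ y, Subgroup.quotientMapOfLE (subgroupOf_le_subgroupOf L hKH) (s y) = y}

/-- The group `L` acts on sections by conjugation, `(g • s) y = g • s (g⁻¹ • y)`. -/
instance CosetSection.instMulAction {G : Type*} [Group G] {K H : Subgroup G} (L : Subgroup G)
    (hKH : K ≤ H) : MulAction L (CosetSection L hKH) where
  smul g s := ⟨fun y => g • s.1 (g⁻¹ • y), fun y => by
    have key : ∀ z : L ⧸ K.subgroupOf L,
        Subgroup.quotientMapOfLE (subgroupOf_le_subgroupOf L hKH) (g • z) =
          g • (Subgroup.quotientMapOfLE (subgroupOf_le_subgroupOf L hKH) z : L ⧸ H.subgroupOf L) := by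
      intro z
      induction z using QuotientGroup.induction_on
      rfl
    rw [key, s.2, smul_inv_smul]⟩
  one_smul s := Subtype.ext (funext fun y => by
    change (1 : L) • s.1 ((1 : L)⁻¹ • y) = s.1 y
    simp)
  mul_smul g h s := Subtype.ext (funext fun y => by
    change (g * h) • s.1 ((g * h)⁻¹ • y) = g • (h • s.1 (h⁻¹ • (g⁻¹ • y)))
    simp [mul_smul])

/-- The stabilizer in `L` of an element of an `L`-set, as a subgroup of `G`. -/
def stabIn {G : Type*} [Group G] (L : Subgroup G) {X : Type*} [MulAction L X] (x : X) :
    Subgroup G :=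
  (MulAction.stabilizer L x).map L.subtype

theorem stabIn_le {G : Type*} [Group G] (L : Subgroup G) {X : Type*} [MulAction L X] (x : X) :
    stabIn L x ≤ L :=
  Subgroup.map_subtype_le _

/-- A `G`-Tambara functor, presented by its values `obj H = T(G/H)` on orbits.

Here `MulAut.conj g • H` is the subgroup `g H g⁻¹`. The conjugation
`T(G/H) → T(G/gHg⁻¹)` takes the target subgroup together with a proof that it equals `gHg⁻¹`.
All formulas that involve representatives of cosets or orbits are required for every choice of
representatives. -/
structure TambaraFunctor (G : Type*) [Group G] [Finite G] where
  obj : Subgroup G → Type*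
  [commRing : ∀ H, CommRing (obj H)]
  /-- restriction `T(G/H) → T(G/K)` for `K ≤ H` -/
  res : ∀ {K H : Subgroup G}, K ≤ H → obj H →+* obj K
  /-- transfer `T(G/K) → T(G/H)` for `K ≤ H` -/
  tr : ∀ {K H : Subgroup G}, K ≤ H → obj K →+ obj H
  /-- norm `T(G/K) → T(G/H)` for `K ≤ H` -/
  norm : ∀ {K H : Subgroup G}, K ≤ H → obj K →* obj H
  /-- conjugation `T(G/H) → T(G/gHg⁻¹)` -/
  conj : ∀ (g : G) {H H' : Subgroup G}, MulAut.conj g • H = H' → obj H ≃+* obj H'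
  res_refl : ∀ {H : Subgroup G} (h : H ≤ H) (x : obj H), res h x = x
  tr_refl : ∀ {H : Subgroup G} (h : H ≤ H) (x : obj H), tr h x = x
  norm_refl : ∀ {H : Subgroup G} (h : H ≤ H) (x : obj H), norm h x = x
  conj_self : ∀ {H : Subgroup G} (g : G), g ∈ H → ∀ (e : MulAut.conj g • H = H) (x : obj H),
    conj g e x = x
  res_res : ∀ {L K H : Subgroup G} (h₁ : L ≤ K) (h₂ : K ≤ H) (x : obj H),
    res h₁ (res h₂ x) = res (h₁.trans h₂) x
  tr_tr : ∀ {L K H : Subgroup G} (h₁ : L ≤ K) (h₂ : K ≤ H) (x : obj L),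
    tr h₂ (tr h₁ x) = tr (h₁.trans h₂) x
  norm_norm : ∀ {L K H : Subgroup G} (h₁ : L ≤ K) (h₂ : K ≤ H) (x : obj L),
    norm h₂ (norm h₁ x) = norm (h₁.trans h₂) x
  conj_conj : ∀ (g h : G) {H H' H'' : Subgroup G} (e : MulAut.conj h • H = H')
    (e' : MulAut.conj g • H' = H'') (e'' : MulAut.conj (g * h) • H = H'') (x : obj H),
    conj g e' (conj h e x) = conj (g * h) e'' x
  conj_res : ∀ (g : G) {K H K' H' : Subgroup G} (h : K ≤ H) (h' : K' ≤ H')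
    (eK : MulAut.conj g • K = K') (eH : MulAut.conj g • H = H') (x : obj H),
    conj g eK (res h x) = res h' (conj g eH x)
  conj_tr : ∀ (g : G) {K H K' H' : Subgroup G} (h : K ≤ H) (h' : K' ≤ H')
    (eK : MulAut.conj g • K = K') (eH : MulAut.conj g • H = H') (x : obj K),
    conj g eH (tr h x) = tr h' (conj g eK x)
  conj_norm : ∀ (g : G) {K H K' H' : Subgroup G} (h : K ≤ H) (h' : K' ≤ H')
    (eK : MulAut.conj g • K = K') (eH : MulAut.conj g • H = H') (x : obj K),
    conj g eH (norm h x) = norm h' (conj g eK x)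
  /-- additive double coset formula -/
  res_tr : ∀ {H L K : Subgroup G} (hH : H ≤ K) (hL : L ≤ K) (x : obj H) (Γ : Finset K),
    IsDoubleCosetTransversal (L.subgroupOf K) H Γ →
    res hL (tr hH x) =
      ∑ γ ∈ Γ, tr (inf_le_left : L ⊓ MulAut.conj (γ : G) • H ≤ L)
        (res inf_le_right (conj (γ : G) rfl x))
  /-- multiplicative double coset formula -/
  res_norm : ∀ {H L K : Subgroup G} (hH : H ≤ K) (hL : L ≤ K) (x : obj H) (Γ : Finset K),
    IsDoubleCosetTransversal (L.subgroupOf K) H Γ →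
    res hL (norm hH x) =
      ∏ γ ∈ Γ, norm (inf_le_left : L ⊓ MulAut.conj (γ : G) • H ≤ L)
        (res inf_le_right (conj (γ : G) rfl x))
  /-- Frobenius reciprocity -/
  frobenius : ∀ {K H : Subgroup G} (h : K ≤ H) (x : obj H) (y : obj K),
    tr h (res h x * y) = x * tr h y
  /-- Tambara reciprocity for sums: the norm of `a + b` from `H` to `L` is a sum over the
  `L`-orbits of functions `f : L / H → {a, b}`. -/
  norm_add : ∀ {H L : Subgroup G} (h : H ≤ L) (a b : obj H) (R : Finset (TwoColoring H L))
    (Γ : TwoColoring H L → Finset L),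
    IsTransversal (MulAction.orbitRel L (TwoColoring H L)) R →
    (∀ f ∈ R, IsDoubleCosetTransversal (MulAction.stabilizer L f) H (Γ f)) →
    norm h (a + b) =
      ∑ f ∈ R, tr (stabIn_le L f)
        (∏ γ ∈ Γ f, norm (inf_le_left : stabIn L f ⊓ MulAut.conj (γ : G) • H ≤ stabIn L f)
          (res inf_le_right (conj (γ : G) rfl (bif f (QuotientGroup.mk γ) then a else b))))
  /-- Tambara reciprocity for transfers: the norm from `H` to `L` of the transfer of `a` from `K`
  to `H` is a sum over the `L`-orbits of sections `s` of `L / K → L / H`. Here `ρ s γ` is a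
  representative in `L` of the coset `s (γ H)`, and `stabIn L s ⊓ γ H γ⁻¹` is the same subgroup
  as `stabIn L s ⊓ (ρ s γ) K (ρ s γ)⁻¹`, since `s` is equivariant for the stabilizer of `s`. -/
  norm_tr : ∀ {K H L : Subgroup G} (hKH : K ≤ H) (h : H ≤ L) (a : obj K)
    (R : Finset (CosetSection L hKH)) (Γ : CosetSection L hKH → Finset L)
    (ρ : CosetSection L hKH → L → L),
    IsTransversal (MulAction.orbitRel L (CosetSection L hKH)) R →
    (∀ s ∈ R, IsDoubleCosetTransversal (MulAction.stabilizer L s) H (Γ s)) →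
    (∀ s ∈ R, ∀ γ ∈ Γ s, (QuotientGroup.mk (ρ s γ) : L ⧸ K.subgroupOf L) =
      s.1 (QuotientGroup.mk γ)) →
    norm h (tr hKH a) =
      ∑ s ∈ R, tr (stabIn_le L s)
        (∏ γ ∈ Γ s,
          norm (inf_le_left : stabIn L s ⊓ MulAut.conj (ρ s γ : G) • K ≤ stabIn L s)
            (res inf_le_right (conj (ρ s γ : G) rfl a)))

attribute [instance] TambaraFunctor.commRing

section TambaraIdeals

variable {G : Type*} [Group G] [Finite G]

/-- `T = 0`: all the rings `T(G/H)` are zero. -/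
def TambaraFunctor.IsZero (T : TambaraFunctor G) : Prop :=
  ∀ H, Subsingleton (T.obj H)

/-- A Tambara ideal: a family of ideals `I(G/H) ⊆ T(G/H)` closed under restriction, transfer,
norm, with `c_g(I(G/H)) = I(G/gHg⁻¹)`. -/
structure TambaraIdeal (T : TambaraFunctor G) where
  carrier : ∀ H : Subgroup G, Ideal (T.obj H)
  res_mem : ∀ {K H : Subgroup G} (h : K ≤ H) {x : T.obj H}, x ∈ carrier H → T.res h x ∈ carrier K
  tr_mem : ∀ {K H : Subgroup G} (h : K ≤ H) {x : T.obj K}, x ∈ carrier K → T.tr h x ∈ carrier H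
  norm_mem : ∀ {K H : Subgroup G} (h : K ≤ H) {x : T.obj K},
    x ∈ carrier K → T.norm h x ∈ carrier H
  conj_image : ∀ (g : G) {H H' : Subgroup G} (e : MulAut.conj g • H = H'),
    T.conj g e '' (carrier H : Set (T.obj H)) = carrier H'

namespace TambaraIdeal

variable {T : TambaraFunctor G}

@[ext]
theorem ext' {I J : TambaraIdeal T} (h : ∀ H, I.carrier H = J.carrier H) : I = J := by
  cases I; cases J
  congr
  exact funext h

/-- Tambara ideals are ordered by levelwise inclusion. -/
instance : PartialOrder (TambaraIdeal T) where
  le I J := ∀ H, I.carrier H ≤ J.carrier H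
  le_refl _ _ := le_rfl
  le_trans _ _ _ h₁ h₂ H := (h₁ H).trans (h₂ H)
  le_antisymm _ _ h₁ h₂ := ext' fun H => le_antisymm (h₁ H) (h₂ H)

theorem conj_mem (I : TambaraIdeal T) (g : G) {H H' : Subgroup G} (e : MulAut.conj g • H = H')
    {x : T.obj H} (hx : x ∈ I.carrier H) : T.conj g e x ∈ I.carrier H' := by
  have h := I.conj_image g e
  exact (Set.ext_iff.1 h _).1 ⟨x, hx, rfl⟩

/-- To check compatibility with conjugation it suffices to check inclusions. -/
theorem conj_image_of_mem (c : ∀ H : Subgroup G, Set (T.obj H))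
    (hc : ∀ (g : G) {H H' : Subgroup G} (e : MulAut.conj g • H = H') {x : T.obj H},
      x ∈ c H → T.conj g e x ∈ c H')
    (g : G) {H H' : Subgroup G} (e : MulAut.conj g • H = H') : T.conj g e '' c H = c H' := by
  ext y
  constructor
  · rintro ⟨x, hx, rfl⟩
    exact hc g e hx
  · intro hy
    have e' : MulAut.conj g⁻¹ • H' = H := by rw [← e, map_inv, inv_smul_smul]
    refine ⟨T.conj g⁻¹ e' y, hc _ _ hy, ?_⟩
    have e'' : MulAut.conj (g * g⁻¹) • H' = H' := by simp
    rw [T.conj_conj g g⁻¹ e' e e'']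
    exact T.conj_self _ (by simp) _ _

/-- The levelwise intersection of a set of Tambara ideals. -/
instance : InfSet (TambaraIdeal T) where
  sInf S :=
    { carrier := fun H => ⨅ I ∈ S, I.carrier H
      res_mem := fun h x hx => by
        simp only [Submodule.mem_iInf] at hx ⊢
        exact fun I hI => I.res_mem h (hx I hI)
      tr_mem := fun h x hx => by
        simp only [Submodule.mem_iInf] at hx ⊢
        exact fun I hI => I.tr_mem h (hx I hI)
      norm_mem := fun h x hx => by
        simp only [Submodule.mem_iInf] at hx ⊢
        exact fun I hI => I.norm_mem h (hx I hI)
      conj_image := conj_image_of_mem _ fun g _ _ e x hx => by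
        simp only [SetLike.mem_coe, Submodule.mem_iInf] at hx ⊢
        exact fun I hI => I.conj_mem g e (hx I hI) }

theorem mem_sInf {S : Set (TambaraIdeal T)} {H : Subgroup G} {x : T.obj H} :
    x ∈ (sInf S).carrier H ↔ ∀ I ∈ S, x ∈ I.carrier H := by
  change x ∈ (⨅ I ∈ S, I.carrier H) ↔ _
  simp only [Submodule.mem_iInf]

/-- The Tambara ideal generated by a family of subsets of the rings `T(G/H)`. -/
def span (X : ∀ H : Subgroup G, Set (T.obj H)) : TambaraIdeal T :=
  sInf {I | ∀ H, X H ⊆ I.carrier H}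

theorem subset_span (X : ∀ H : Subgroup G, Set (T.obj H)) (H : Subgroup G) :
    X H ⊆ (span X).carrier H :=
  fun _ hx => mem_sInf.2 fun _ hI => hI H hx

theorem span_le {X : ∀ H : Subgroup G, Set (T.obj H)} {I : TambaraIdeal T} :
    span X ≤ I ↔ ∀ H, X H ⊆ I.carrier H :=
  ⟨fun h H _ hx => h H (subset_span X H hx), fun h _ _ hx => mem_sInf.1 hx I h⟩

/-- The principal Tambara ideal `⟨x⟩`, the smallest one that contains `x ∈ T(G/H)`. -/
def principal (H : Subgroup G) (x : T.obj H) : TambaraIdeal T :=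
  sInf {I | x ∈ I.carrier H}

theorem principal_le {H : Subgroup G} {x : T.obj H} {I : TambaraIdeal T} :
    principal H x ≤ I ↔ x ∈ I.carrier H :=
  ⟨fun h => h H (mem_sInf.2 fun _ hI => hI), fun h _ _ hy => mem_sInf.1 hy I h⟩

/-- The unit ideal `T`. -/
instance : Top (TambaraIdeal T) where
  top :=
    { carrier := fun _ => ⊤
      res_mem := fun _ _ _ => trivial
      tr_mem := fun _ _ _ => trivial
      norm_mem := fun _ _ _ => trivial
      conj_image := conj_image_of_mem _ fun _ _ _ _ _ _ => trivial }

/-- The product `I J` is the Tambara ideal generated by the levelwise products. -/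
instance : Mul (TambaraIdeal T) where
  mul I J := span fun H => ((I.carrier H * J.carrier H : Ideal (T.obj H)) : Set (T.obj H))

/-- The `n`-fold product `Iⁿ`, with `I⁰ = T`. -/
def pow (I : TambaraIdeal T) : ℕ → TambaraIdeal T
  | 0 => ⊤
  | n + 1 => pow I n * I

theorem mul_le {I J K : TambaraIdeal T} :
    I * J ≤ K ↔ ∀ H, ∀ a ∈ I.carrier H, ∀ b ∈ J.carrier H, a * b ∈ K.carrier H := by
  refine span_le.trans (forall_congr' fun H => ?_)
  exact Ideal.mul_le

theorem mul_mono {I I' J J' : TambaraIdeal T} (h : I ≤ I') (h' : J ≤ J') : I * J ≤ I' * J' :=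
  mul_le.2 fun H a ha b hb => mul_le.1 le_rfl H a (h H ha) b (h' H hb)

theorem pow_mono {I J : TambaraIdeal T} (h : I ≤ J) (n : ℕ) : pow I n ≤ pow J n := by
  induction n with
  | zero => exact le_rfl
  | succ n ih => exact mul_mono ih h

end TambaraIdeal

theorem IsDoubleCosetTransversal.nonempty {G : Type*} [Group G] {L : Subgroup G} {A : Subgroup L} {H : Subgroup G}
    {Γ : Finset L} (h : IsDoubleCosetTransversal A H Γ) : Γ.Nonempty := by
  obtain ⟨b, ⟨hb, -⟩, -⟩ := h 1
  exact ⟨b, hb⟩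

instance (H L : Subgroup G) : Finite (TwoColoring H L) :=
  inferInstanceAs (Finite ((L ⧸ H.subgroupOf L) → Bool))

theorem TwoColoring.smul_apply {G : Type*} [Group G] {H L : Subgroup G} (g : L) (f : TwoColoring H L)
    (y : L ⧸ H.subgroupOf L) : (g • f) y = f (g⁻¹ • y) :=
  rfl

/-- The formula for the norm of a sum, for some choice of representatives. -/
theorem TambaraFunctor.exists_norm_add (T : TambaraFunctor G) {H L : Subgroup G} (h : H ≤ L)
    (a b : T.obj H) : ∃ (R : Finset (TwoColoring H L)) (Γ : TwoColoring H L → Finset L),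
    IsTransversal (MulAction.orbitRel L (TwoColoring H L)) R ∧
    (∀ f, IsDoubleCosetTransversal (MulAction.stabilizer L f) H (Γ f)) ∧
    T.norm h (a + b) =
      ∑ f ∈ R, T.tr (stabIn_le L f)
        (∏ γ ∈ Γ f, T.norm (inf_le_left : stabIn L f ⊓ MulAut.conj (γ : G) • H ≤ stabIn L f)
          (T.res inf_le_right
            (T.conj (γ : G) rfl (bif f (QuotientGroup.mk γ) then a else b)))) := by
  obtain ⟨R, hR⟩ := IsTransversal.exists (MulAction.orbitRel L (TwoColoring H L))
  choose Γ hΓ using fun f : TwoColoring H L => IsTransversal.exists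
    (DoubleCoset.setoid (MulAction.stabilizer L f : Set L) (H.subgroupOf L : Set L))
  exact ⟨R, Γ, hR, hΓ, T.norm_add h a b R Γ hR fun f _ => hΓ f⟩

theorem TwoColoring.eq_of_stabIn_eq {G : Type*} [Group G] {H L : Subgroup G} {f : TwoColoring H L}
    (hf : stabIn L f = L) (y : L ⧸ H.subgroupOf L) :
    f y = f (QuotientGroup.mk (1 : L)) := by
  induction y using QuotientGroup.induction_on with
  | H z =>
    have hz : (z : G) ∈ stabIn L f := by rw [hf]; exact z.2
    obtain ⟨w, hw, hwz⟩ := hz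
    have : w = z := Subtype.ext hwz
    subst this
    have h1 : w • f = f := hw
    have h2 := congrFun h1 (QuotientGroup.mk w : L ⧸ H.subgroupOf L)
    rw [TwoColoring.smul_apply] at h2
    rw [← h2]
    congr 1
    change (QuotientGroup.mk (w⁻¹ * w) : L ⧸ H.subgroupOf L) = _
    simp

theorem TambaraFunctor.norm_zero_aux (T : TambaraFunctor G) {H L S : Subgroup G} (h : H ≤ L)
    (hS : S = L) (hSL : S ≤ L) (γ : L) :
    T.tr hSL (T.norm (inf_le_left : S ⊓ MulAut.conj (γ : G) • H ≤ S) 0) = T.norm h 0 := by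
  subst hS
  rw [T.tr_refl]
  have e : MulAut.conj (γ : G) • S = S := Subgroup.conj_smul_eq_self_of_mem γ.2
  have h' : MulAut.conj (γ : G) • H ≤ S := by
    conv_rhs => rw [← e]
    exact Subgroup.pointwise_smul_le_pointwise_smul_iff.2 h
  have h1 := T.conj_norm (γ : G) h h' rfl e 0
  rw [T.conj_self _ γ.2, map_zero (T.conj _ _)] at h1
  rw [h1]
  have h2 : S ⊓ MulAut.conj (γ : G) • H = MulAut.conj (γ : G) • H := inf_eq_right.2 h'
  have h3 : ∀ M (hM : M = MulAut.conj (γ : G) • H) (hMS : M ≤ S),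
      T.norm hMS 0 = T.norm h' 0 := by
    rintro _ rfl _
    rfl
  exact h3 _ h2 _

/-- Norms preserve zero; this is needed for the zero ideal to be a Tambara ideal. -/
theorem TambaraFunctor.norm_zero (T : TambaraFunctor G) :
    ∀ {H L : Subgroup G} (h : H ≤ L), T.norm h 0 = 0 := by
  suffices ∀ (n : ℕ) (L : Subgroup G), Nat.card L = n → ∀ {H : Subgroup G} (h : H ≤ L),
      T.norm h 0 = 0 from fun {H L} h => this _ L rfl h
  intro n
  induction n using Nat.strong_induction_on with
  | _ n ih =>
  intro L hL H h
  obtain ⟨R, Γ, hR, hΓ, hsum⟩ := T.exists_norm_add h 0 0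
  simp only [Bool.cond_self, map_zero] at hsum
  have hlt : ∀ f : TwoColoring H L, stabIn L f ≠ L → T.tr (stabIn_le L f)
      (∏ γ ∈ Γ f, T.norm
        (inf_le_left : stabIn L f ⊓ MulAut.conj (γ : G) • H ≤ stabIn L f) 0) = 0 := by
    intro f hf
    have hcard : Nat.card (stabIn L f) < n := by
      rw [← hL]
      exact Set.ncard_lt_ncard ((stabIn_le L f).lt_of_ne hf) (Set.toFinite _)
    obtain ⟨γ, hγ⟩ := (hΓ f).nonempty
    rw [Finset.prod_eq_zero hγ (ih _ hcard _ rfl _), map_zero]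
  have heq : ∀ f : TwoColoring H L, stabIn L f = L → T.tr (stabIn_le L f)
      (∏ γ ∈ Γ f, T.norm
        (inf_le_left : stabIn L f ⊓ MulAut.conj (γ : G) • H ≤ stabIn L f) 0) =
        T.norm h 0 := by
    intro f hf
    obtain ⟨γ, hγ⟩ := (hΓ f).nonempty
    have hstab : MulAction.stabilizer L f = ⊤ := by
      rw [eq_top_iff]
      intro z _
      have hz : (z : G) ∈ stabIn L f := by rw [hf]; exact z.2
      obtain ⟨w, hw, hwz⟩ := hz
      rwa [← (Subtype.ext hwz : w = z)]
    have hsing : Γ f = {γ} := by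
      refine Finset.eq_singleton_iff_unique_mem.2 ⟨hγ, fun γ' hγ' => ?_⟩
      refine (hΓ f γ).unique ⟨hγ', ?_⟩ ⟨hγ, Setoid.refl' _ _⟩
      rw [DoubleCoset.rel_iff]
      refine ⟨γ' * γ⁻¹, by rw [hstab]; trivial, 1, one_mem _, by simp⟩
    rw [hsing, Finset.prod_singleton]
    exact T.norm_zero_aux h hf _ γ
  let c : Bool → TwoColoring H L := fun v _ => v
  have hc : ∀ v, stabIn L (c v) = L := by
    intro v
    refine le_antisymm (stabIn_le L _) fun z hz => ?_
    exact ⟨⟨z, hz⟩, (rfl : (⟨z, hz⟩ : L) • c v = c v), rfl⟩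
  have hcR : ∀ v, c v ∈ R := by
    intro v
    obtain ⟨f, ⟨hf, hvf⟩, -⟩ := hR (c v)
    obtain ⟨g, hg⟩ := hvf
    have hg' : g • f = c v := hg
    have : f = c v := by
      rw [← inv_smul_eq_iff.2 hg'.symm]
      rfl
    rwa [← this]
  have hne : c true ≠ c false := fun h0 => by
    have := congrFun h0 (QuotientGroup.mk (1 : L))
    simp [c] at this
  classical
  have hsub : ({c true, c false} : Finset (TwoColoring H L)) ⊆ R := by
    intro f hf
    rcases Finset.mem_insert.1 hf with rfl | hf
    · exact hcR _
    · rw [Finset.mem_singleton.1 hf]; exact hcR _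
  rw [← Finset.sum_subset hsub, Finset.sum_pair hne, heq _ (hc _), heq _ (hc _), add_zero] at hsum
  · simpa using hsum
  · intro f _ hf
    refine hlt f fun hst => hf ?_
    have hfc : f = c (f (QuotientGroup.mk (1 : L))) :=
      funext fun y => TwoColoring.eq_of_stabIn_eq hst y
    rw [hfc]
    cases f (QuotientGroup.mk (1 : L)) <;> simp

namespace TambaraIdeal

variable {T : TambaraFunctor G}

/-- The zero ideal. -/
instance : Bot (TambaraIdeal T) where
  bot :=
    { carrier := fun _ => ⊥
      res_mem := fun h x hx => by
        rw [Ideal.mem_bot] at hx ⊢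
        rw [hx, map_zero]
      tr_mem := fun h x hx => by
        rw [Ideal.mem_bot] at hx ⊢
        rw [hx, map_zero]
      norm_mem := fun h x hx => by
        rw [Ideal.mem_bot] at hx ⊢
        rw [hx, T.norm_zero]
      conj_image := conj_image_of_mem _ fun g _ _ e x hx => by
        rw [SetLike.mem_coe, Ideal.mem_bot] at hx ⊢
        rw [hx, map_zero] }

/-- The levelwise sum of two Tambara ideals. -/
def add (I J : TambaraIdeal T) : TambaraIdeal T where
  carrier H := I.carrier H ⊔ J.carrier H
  res_mem h x hx := by
    obtain ⟨a, ha, b, hb, rfl⟩ := Submodule.mem_sup.1 hx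
    rw [map_add]
    exact Submodule.add_mem_sup (I.res_mem h ha) (J.res_mem h hb)
  tr_mem h x hx := by
    obtain ⟨a, ha, b, hb, rfl⟩ := Submodule.mem_sup.1 hx
    rw [map_add]
    exact Submodule.add_mem_sup (I.tr_mem h ha) (J.tr_mem h hb)
  norm_mem {K H} h x hx := by
    obtain ⟨a, ha, b, hb, rfl⟩ := Submodule.mem_sup.1 hx
    obtain ⟨R, Γ, -, hΓ, hsum⟩ := T.exists_norm_add h a b
    rw [hsum]
    refine sum_mem fun f _ => ?_
    obtain ⟨γ, hγ⟩ := (hΓ f).nonempty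
    cases hfγ : f (QuotientGroup.mk γ) with
    | true =>
      refine Ideal.mem_sup_left (I.tr_mem _ (Ideal.mem_of_dvd _ (Finset.dvd_prod_of_mem _ hγ) ?_))
      rw [hfγ]
      exact I.norm_mem _ (I.res_mem _ (I.conj_mem _ _ ha))
    | false =>
      refine Ideal.mem_sup_right (J.tr_mem _ (Ideal.mem_of_dvd _ (Finset.dvd_prod_of_mem _ hγ) ?_))
      rw [hfγ]
      exact J.norm_mem _ (J.res_mem _ (J.conj_mem _ _ hb))
  conj_image := conj_image_of_mem _ fun g _ _ e x hx => by
    obtain ⟨a, ha, b, hb, rfl⟩ := Submodule.mem_sup.1 hx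
    rw [map_add]
    exact Submodule.add_mem_sup (I.conj_mem g e ha) (J.conj_mem g e hb)

theorem le_add_left (I J : TambaraIdeal T) : I ≤ add I J := fun _ => le_sup_left

theorem le_add_right (I J : TambaraIdeal T) : J ≤ add I J := fun _ => le_sup_right

theorem add_le {I J K : TambaraIdeal T} (h : I ≤ K) (h' : J ≤ K) : add I J ≤ K :=
  fun H => sup_le (h H) (h' H)

theorem mul_le_left (I J : TambaraIdeal T) : I * J ≤ I :=
  mul_le.2 fun H _ ha b _ => (I.carrier H).mul_mem_right b ha

theorem mul_add_le (A I J : TambaraIdeal T) : A * add I J ≤ add (A * I) (A * J) := by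
  refine mul_le.2 fun H a ha x hx => ?_
  obtain ⟨b, hb, c, hc, rfl⟩ := Submodule.mem_sup.1 hx
  rw [_root_.mul_add]
  exact Submodule.add_mem_sup (mul_le.1 le_rfl H a ha b hb) (mul_le.1 le_rfl H a ha c hc)

theorem add_mul_le (I J A : TambaraIdeal T) : add I J * A ≤ add (I * A) (J * A) := by
  refine mul_le.2 fun H x hx a ha => ?_
  obtain ⟨b, hb, c, hc, rfl⟩ := Submodule.mem_sup.1 hx
  rw [_root_.add_mul]
  exact Submodule.add_mem_sup (mul_le.1 le_rfl H b hb a ha) (mul_le.1 le_rfl H c hc a ha)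

/-- Multiplication of `A` by `I` on the right, `n` times. -/
def mulPow (A I : TambaraIdeal T) : ℕ → TambaraIdeal T
  | 0 => A
  | n + 1 => mulPow (A * I) I n

theorem mulPow_succ (A I : TambaraIdeal T) (n : ℕ) : mulPow A I (n + 1) = mulPow A I n * I := by
  induction n generalizing A with
  | zero => rfl
  | succ n ih => exact ih (A * I)

theorem pow_eq_mulPow (I : TambaraIdeal T) (n : ℕ) : pow I n = mulPow ⊤ I n := by
  induction n with
  | zero => rfl
  | succ n ih => rw [mulPow_succ, ← ih]; rfl

theorem mulPow_mono {A B : TambaraIdeal T} (h : A ≤ B) (I : TambaraIdeal T) (n : ℕ) :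
    mulPow A I n ≤ mulPow B I n := by
  induction n generalizing A B with
  | zero => exact h
  | succ n ih => exact ih (mul_mono h le_rfl)

theorem mulPow_le (A I : TambaraIdeal T) (n : ℕ) : mulPow A I n ≤ A := by
  induction n generalizing A with
  | zero => exact le_rfl
  | succ n ih => exact (ih _).trans (mul_le_left A I)

theorem mulPow_add_le (A B I : TambaraIdeal T) (n : ℕ) :
    mulPow (add A B) I n ≤ add (mulPow A I n) (mulPow B I n) := by
  induction n generalizing A B with
  | zero => exact le_rfl
  | succ n ih => exact (mulPow_mono (add_mul_le A B I) I n).trans (ih _ _)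

/-- If `A Iⁿ ⊆ K` and `A Jᵐ ⊆ K`, then `A (I + J)ⁿ⁺ᵐ ⊆ K`. -/
theorem mulPow_add_pow_le {I J K : TambaraIdeal T} (k : ℕ) :
    ∀ (n m : ℕ) (A : TambaraIdeal T), n + m = k → mulPow A I n ≤ K → mulPow A J m ≤ K →
      mulPow A (add I J) k ≤ K := by
  induction k with
  | zero =>
    intro n m A hnm h _
    obtain rfl : n = 0 := by omega
    exact h
  | succ k ih =>
    intro n m A hnm hn hm
    rcases n with _ | n
    · exact (mulPow_le A _ _).trans hn
    rcases m with _ | m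
    · exact (mulPow_le A _ _).trans hm
    refine (mulPow_mono (mul_add_le A I J) _ k).trans ((mulPow_add_le _ _ _ k).trans
      (add_le ?_ ?_))
    · exact ih n (m + 1) _ (by omega) hn ((mulPow_mono (mul_le_left A I) _ _).trans hm)
    · exact ih (n + 1) m _ (by omega) ((mulPow_mono (mul_le_left A J) _ _).trans hn) hm

theorem pow_add_le {I J K : TambaraIdeal T} {n m : ℕ} (hn : pow I n ≤ K) (hm : pow J m ≤ K) :
    pow (add I J) (n + m) ≤ K := by
  rw [pow_eq_mulPow] at hn hm ⊢
  exact mulPow_add_pow_le (n + m) n m ⊤ rfl hn hm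

/-- The radical `√I`: `x ∈ T(G/H)` belongs to it iff `⟨x⟩ⁿ ⊆ I` for some `n ≥ 1`. -/
def radical (I : TambaraIdeal T) : TambaraIdeal T :=
  have key : ∀ {H H' : Subgroup G} {x : T.obj H} {y : T.obj H'},
      y ∈ (principal H x).carrier H' → (∃ n : ℕ, 1 ≤ n ∧ pow (principal H x) n ≤ I) →
        ∃ n : ℕ, 1 ≤ n ∧ pow (principal H' y) n ≤ I := by
    rintro H H' x y hy ⟨n, hn, h⟩
    exact ⟨n, hn, (pow_mono (principal_le.2 hy) n).trans h⟩
  have self_mem : ∀ {H : Subgroup G} (x : T.obj H), x ∈ (principal H x).carrier H :=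
    fun _ => principal_le.1 le_rfl
  { carrier := fun H =>
      { carrier := {x | ∃ n : ℕ, 1 ≤ n ∧ pow (principal H x) n ≤ I}
        zero_mem' := by
          refine ⟨1, le_rfl, mul_le.2 fun H' a _ b hb => ?_⟩
          have h0 : principal H (0 : T.obj H) ≤ I := principal_le.2 (zero_mem _)
          exact (I.carrier H').mul_mem_left a (h0 H' hb)
        add_mem' := by
          rintro x y ⟨n, hn, hx⟩ ⟨m, hm, hy⟩
          refine ⟨n + m, by omega, (pow_mono (principal_le.2 ?_) _).trans (pow_add_le hx hy)⟩
          exact Submodule.add_mem_sup (self_mem x) (self_mem y)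
        smul_mem' := fun c _ hx => key (Ideal.mul_mem_left _ c (self_mem _)) hx }
    res_mem := fun h _ hx => key ((principal _ _).res_mem h (self_mem _)) hx
    tr_mem := fun h _ hx => key ((principal _ _).tr_mem h (self_mem _)) hx
    norm_mem := fun h _ hx => key ((principal _ _).norm_mem h (self_mem _)) hx
    conj_image := conj_image_of_mem _ fun g _ _ e _ hx =>
      key ((principal _ _).conj_mem g e (self_mem _)) hx }

/-- A Tambara ideal is prime if it is proper, `1 ∉ P(G/G)`, and `I J ⊆ P` implies `I ⊆ P` or
`J ⊆ P`. -/
def IsPrime (P : TambaraIdeal T) : Prop :=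
  (1 : T.obj ⊤) ∉ P.carrier ⊤ ∧ ∀ I J : TambaraIdeal T, I * J ≤ P → I ≤ P ∨ J ≤ P

end TambaraIdeal

/-- The nilradical `√0`. -/
def TambaraFunctor.nilradical (T : TambaraFunctor G) : TambaraIdeal T :=
  TambaraIdeal.radical ⊥

/-- The Nakaoka spectrum: the set of prime Tambara ideals. -/
def NakaokaSpec (T : TambaraFunctor G) : Type _ :=
  {P : TambaraIdeal T // P.IsPrime}

/-- The topology with the sets `V_H(x) = {P | x ∈ P(G/H)}` as a subbasis of the closed sets. -/
instance (T : TambaraFunctor G) : TopologicalSpace (NakaokaSpec T) :=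
  TopologicalSpace.generateFrom
    {U | ∃ (H : Subgroup G) (x : T.obj H), U = {P : NakaokaSpec T | x ∈ P.1.carrier H}ᶜ}

end TambaraIdeals

/-! As for commutative rings, the nilradical is the intersection of all primes (`mem_radical_iff`
with I = 0), and the theorem follows formally. If √0 is prime, it is a point below every prime, and
open sets are closed under passing to smaller primes, so it lies in every nonempty open set.
Conversely, if IJ ⊆ √0 but neither factor is, pick x in I and y in J, each avoiding some prime;
irreducibility gives a prime avoiding both, although it contains IJ.

The hard inclusion of the intersection formula is Krull's argument: if no power of ⟨x⟩ lies in I, an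
ideal above I that is maximal with this property is prime and avoids x. Two facts that are immediate
for rings need proof, since products of Tambara ideals are only generated by levelwise products:
⟨x⟩ᵐ⟨x⟩ⁿ = ⟨x⟩ᵐ⁺ⁿ, and ⟨x⟩ⁿ is finitely generated, so that Zorn's lemma applies.

Both come from explicit generators. If a family X is stable under restriction, norm and conjugation
up to multiples, the ideal it generates consists of sums of transfers of multiples of elements of X
(`span_carrier_le`). Frobenius reciprocity then gives span X · span Y = span (XY) (`span_mul_span`).
Finally ⟨x⟩ is generated by a finite stable family, the norms of restrictions of conjugates of x. -/

theorem Subgroup.conj_smul_le_conj_mul_smul {G : Type*} [Group G] {A B : Subgroup G} {γ g : G}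
    (hg : A ≤ MulAut.conj g • B) :
    MulAut.conj γ • A ≤ MulAut.conj (γ * g) • B := by
  rw [map_mul, mul_smul]
  exact Subgroup.pointwise_smul_le_pointwise_smul_iff.2 hg

/-! ### Double coset and reciprocity formulas with chosen representatives -/

namespace TambaraFunctor

variable {G : Type*} [Group G] [Finite G] (T : TambaraFunctor G)

theorem exists_res_tr {H L K : Subgroup G} (hH : H ≤ K) (hL : L ≤ K) (x : T.obj H) :
    ∃ Γ : Finset K, T.res hL (T.tr hH x) =
      ∑ γ ∈ Γ, T.tr (inf_le_left : L ⊓ MulAut.conj (γ : G) • H ≤ L)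
        (T.res inf_le_right (T.conj (γ : G) rfl x)) := by
  obtain ⟨Γ, hΓ⟩ := IsTransversal.exists
    (DoubleCoset.setoid (L.subgroupOf K : Set K) (H.subgroupOf K : Set K))
  exact ⟨Γ, T.res_tr hH hL x Γ hΓ⟩

/-- Nonemptiness of `Γ` is recorded because divisibility arguments single out one factor of the
product. -/
theorem exists_res_norm {H L K : Subgroup G} (hH : H ≤ K) (hL : L ≤ K) (x : T.obj H) :
    ∃ Γ : Finset K, Γ.Nonempty ∧ T.res hL (T.norm hH x) =
      ∏ γ ∈ Γ, T.norm (inf_le_left : L ⊓ MulAut.conj (γ : G) • H ≤ L)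
        (T.res inf_le_right (T.conj (γ : G) rfl x)) := by
  obtain ⟨Γ, hΓ⟩ := IsTransversal.exists
    (DoubleCoset.setoid (L.subgroupOf K : Set K) (H.subgroupOf K : Set K))
  exact ⟨Γ, IsDoubleCosetTransversal.nonempty hΓ, T.res_norm hH hL x Γ hΓ⟩

instance {K H : Subgroup G} (L : Subgroup G) (hKH : K ≤ H) : Finite (CosetSection L hKH) :=
  inferInstanceAs (Finite {s : (L ⧸ H.subgroupOf L) → (L ⧸ K.subgroupOf L) //
    ∀ y, Subgroup.quotientMapOfLE (subgroupOf_le_subgroupOf L hKH) (s y) = y})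

/-- The formula for the norm of a transfer, for some choice of representatives. -/
theorem exists_norm_tr {K H L : Subgroup G} (hKH : K ≤ H) (h : H ≤ L) (a : T.obj K) :
    ∃ (R : Finset (CosetSection L hKH)) (Γ : CosetSection L hKH → Finset L)
      (ρ : CosetSection L hKH → L → L), (∀ s, (Γ s).Nonempty) ∧
      T.norm h (T.tr hKH a) =
        ∑ s ∈ R, T.tr (stabIn_le L s)
          (∏ γ ∈ Γ s,
            T.norm (inf_le_left : stabIn L s ⊓ MulAut.conj (ρ s γ : G) • K ≤ stabIn L s)
              (T.res inf_le_right (T.conj (ρ s γ : G) rfl a))) := by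
  obtain ⟨R, hR⟩ := IsTransversal.exists (MulAction.orbitRel L (CosetSection L hKH))
  choose Γ hΓ using fun s : CosetSection L hKH => IsTransversal.exists
    (DoubleCoset.setoid (MulAction.stabilizer L s : Set L) (H.subgroupOf L : Set L))
  refine ⟨R, Γ, fun s γ => (s.1 (QuotientGroup.mk γ)).out,
    fun s => IsDoubleCosetTransversal.nonempty (hΓ s), ?_⟩
  exact T.norm_tr hKH h a R Γ _ hR (fun s _ => hΓ s) fun s _ γ _ => Quotient.out_eq _

theorem conj_res_conj {A B : Subgroup G} (γ g : G) (hg : A ≤ MulAut.conj g • B)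
    {A' : Subgroup G} (e : MulAut.conj γ • A = A') (h' : A' ≤ MulAut.conj (γ * g) • B)
    (x : T.obj B) :
    T.conj γ e (T.res hg (T.conj g rfl x)) = T.res h' (T.conj (γ * g) rfl x) := by
  have eB : MulAut.conj γ • (MulAut.conj g • B) = MulAut.conj (γ * g) • B := by
    rw [map_mul, mul_smul]
  rw [T.conj_res γ hg h' e eB, T.conj_conj γ g rfl eB rfl]

theorem norm_res_of_eq {K H L : Subgroup G} (e : K = H) (hK : K ≤ L) (hKH : K ≤ H) (hH : H ≤ L)
    (a : T.obj H) : T.norm hK (T.res hKH a) = T.norm hH a := by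
  subst e
  rw [T.res_refl]

/-- Conjugating by an element of the target does not affect membership of a norm. -/
theorem norm_res_conj_mem {H L S : Subgroup G} (c : ∀ H : Subgroup G, Set (T.obj H)) (h : H ≤ L)
    (hS : S = L) (γ : L) {a : T.obj H} (ha : T.norm h a ∈ c L) :
    T.norm (inf_le_left : S ⊓ MulAut.conj (γ : G) • H ≤ S)
      (T.res inf_le_right (T.conj (γ : G) rfl a)) ∈ c S := by
  subst hS
  have e : MulAut.conj (γ : G) • S = S := Subgroup.conj_smul_eq_self_of_mem γ.2
  have h' : MulAut.conj (γ : G) • H ≤ S := by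
    conv_rhs => rw [← e]
    exact Subgroup.pointwise_smul_le_pointwise_smul_iff.2 h
  have h1 := T.conj_norm (γ : G) h h' rfl e a
  rw [T.conj_self _ γ.2] at h1
  rwa [T.norm_res_of_eq (inf_eq_right.2 h') _ _ h', ← h1]

end TambaraFunctor

/-! ### Stable families and the ideals they generate -/

namespace TambaraIdeal

variable {G : Type*} [Group G] [Finite G] {T : TambaraFunctor G}

/-- A family of subsets that is closed under restrictions, norms and conjugations up to taking
multiples. -/
structure IsStable (X : ∀ H : Subgroup G, Set (T.obj H)) : Prop where
  res : ∀ {K H : Subgroup G} (h : K ≤ H) {x : T.obj H}, x ∈ X H → ∃ y ∈ X K, y ∣ T.res h x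
  norm : ∀ {K H : Subgroup G} (h : K ≤ H) {x : T.obj K}, x ∈ X K → ∃ y ∈ X H, y ∣ T.norm h x
  conj : ∀ (g : G) {H H' : Subgroup G} (e : MulAut.conj g • H = H') {x : T.obj H},
    x ∈ X H → ∃ y ∈ X H', y ∣ T.conj g e x

/-- The transfers to `H` of the multiples of elements of the family `X`. -/
def transferSet (X : ∀ H : Subgroup G, Set (T.obj H)) (H : Subgroup G) : Set (T.obj H) :=
  {z | ∃ (K : Subgroup G) (h : K ≤ H) (s w : T.obj K), s ∈ X K ∧ s ∣ w ∧ z = T.tr h w}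

/-- The levelwise ideal of sums of transfers of multiples of elements of `X`. -/
def transferSpan (X : ∀ H : Subgroup G, Set (T.obj H)) (H : Subgroup G) : Ideal (T.obj H) where
  toAddSubmonoid := AddSubmonoid.closure (transferSet X H)
  smul_mem' c x hx := by
    change x ∈ AddSubmonoid.closure (transferSet X H) at hx
    change c * x ∈ AddSubmonoid.closure (transferSet X H)
    induction hx using AddSubmonoid.closure_induction with
    | mem x hx =>
      obtain ⟨K, h, s, w, hs, hsw, rfl⟩ := hx
      exact AddSubmonoid.subset_closure
        ⟨K, h, s, T.res h c * w, hs, hsw.mul_left _, (T.frobenius h c w).symm⟩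
    | zero => rw [mul_zero]; exact zero_mem _
    | add x y _ _ hx hy => rw [mul_add]; exact add_mem hx hy

theorem tr_mem_transferSpan {X : ∀ H : Subgroup G, Set (T.obj H)} {K H : Subgroup G} (h : K ≤ H)
    {s w : T.obj K} (hs : s ∈ X K) (hsw : s ∣ w) : T.tr h w ∈ transferSpan X H :=
  AddSubmonoid.subset_closure ⟨K, h, s, w, hs, hsw, rfl⟩

theorem transferSpan_induction {X : ∀ H : Subgroup G, Set (T.obj H)} {H : Subgroup G}
    {p : ∀ x, x ∈ transferSpan X H → Prop} (zero : p 0 (zero_mem _))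
    (add : ∀ x y (hx : x ∈ transferSpan X H) (hy : y ∈ transferSpan X H), p x hx → p y hy →
      p (x + y) (add_mem hx hy))
    (tr : ∀ (K : Subgroup G) (h : K ≤ H) (s w : T.obj K) (hs : s ∈ X K) (hsw : s ∣ w),
      p (T.tr h w) (tr_mem_transferSpan h hs hsw))
    {x : T.obj H} (hx : x ∈ transferSpan X H) : p x hx := by
  change x ∈ AddSubmonoid.closure (transferSet X H) at hx
  induction hx using AddSubmonoid.closure_induction with
  | mem x hx =>
    obtain ⟨K, h, s, w, hs, hsw, rfl⟩ := hx
    exact tr K h s w hs hsw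
  | zero => exact zero
  | add x y hx hy hpx hpy => exact add x y hx hy hpx hpy

namespace IsStable

variable {X Y : ∀ H : Subgroup G, Set (T.obj H)}

/-- The double coset formulas and the reciprocity for transfers all produce terms that are
restrictions of conjugates; this treats them uniformly. -/
theorem conj_res_dvd (hX : IsStable X) {K H : Subgroup G} (g : G) (h : K ≤ MulAut.conj g • H)
    {s w : T.obj H} (hs : s ∈ X H) (hsw : s ∣ w) :
    ∃ y ∈ X K, y ∣ T.res h (T.conj g rfl w) := by
  obtain ⟨y, hy, hyd⟩ := hX.conj g rfl hs
  obtain ⟨z, hz, hzd⟩ := hX.res h hy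
  exact ⟨z, hz, hzd.trans (map_dvd (T.res h) (hyd.trans (map_dvd (T.conj g rfl) hsw)))⟩

theorem res_mem_transferSpan (hX : IsStable X) {K H : Subgroup G} (h : K ≤ H) {x : T.obj H}
    (hx : x ∈ transferSpan X H) : T.res h x ∈ transferSpan X K := by
  induction hx using transferSpan_induction with
  | zero => rw [map_zero]; exact zero_mem _
  | add x y _ _ hx hy => rw [map_add]; exact add_mem hx hy
  | tr L hL s w hs hsw =>
    obtain ⟨Γ, hΓ⟩ := T.exists_res_tr hL h w
    rw [hΓ]
    refine sum_mem fun γ _ => ?_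
    obtain ⟨y, hy, hyd⟩ := hX.conj_res_dvd (γ : G)
      (inf_le_right : K ⊓ MulAut.conj (γ : G) • L ≤ _) hs hsw
    exact tr_mem_transferSpan _ hy hyd

theorem tr_mem_transferSpan {K H : Subgroup G} (h : K ≤ H) {x : T.obj K}
    (hx : x ∈ transferSpan X K) : T.tr h x ∈ transferSpan X H := by
  induction hx using transferSpan_induction with
  | zero => rw [map_zero]; exact zero_mem _
  | add x y _ _ hx hy => rw [map_add]; exact add_mem hx hy
  | tr L hL s w hs hsw =>
    rw [T.tr_tr]
    exact TambaraIdeal.tr_mem_transferSpan _ hs hsw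

theorem conj_mem_transferSpan (hX : IsStable X) (g : G) {H H' : Subgroup G}
    (e : MulAut.conj g • H = H') {x : T.obj H} (hx : x ∈ transferSpan X H) :
    T.conj g e x ∈ transferSpan X H' := by
  induction hx using transferSpan_induction with
  | zero => rw [map_zero]; exact zero_mem _
  | add x y _ _ hx hy => rw [map_add]; exact add_mem hx hy
  | tr L hL s w hs hsw =>
    have h' : MulAut.conj g • L ≤ H' := by
      rw [← e]; exact Subgroup.pointwise_smul_le_pointwise_smul_iff.2 hL
    rw [T.conj_tr g hL h' rfl e]
    obtain ⟨y, hy, hyd⟩ := hX.conj g rfl hs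
    exact TambaraIdeal.tr_mem_transferSpan _ hy (hyd.trans (map_dvd (T.conj g rfl) hsw))

/-- Tambara reciprocity writes the norm as a sum of transfers of products. A single factor of each
product is already a multiple of an element of X, hence so is the product. -/
theorem norm_tr_mem_transferSpan (hX : IsStable X) {K H L : Subgroup G} (hKH : K ≤ H) (h : H ≤ L)
    {s w : T.obj K} (hs : s ∈ X K) (hsw : s ∣ w) :
    T.norm h (T.tr hKH w) ∈ transferSpan X L := by
  obtain ⟨R, Γ, ρ, hΓ, hsum⟩ := T.exists_norm_tr hKH h w
  rw [hsum]
  refine sum_mem fun f _ => ?_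
  obtain ⟨γ, hγ⟩ := hΓ f
  obtain ⟨y, hy, hyd⟩ := hX.conj_res_dvd (ρ f γ : G)
    (inf_le_right : stabIn L f ⊓ MulAut.conj (ρ f γ : G) • K ≤ _) hs hsw
  obtain ⟨z, hz, hzd⟩ := hX.norm (inf_le_left : stabIn L f ⊓ MulAut.conj (ρ f γ : G) • K ≤ _) hy
  exact TambaraIdeal.tr_mem_transferSpan _ hz
    ((hzd.trans (map_dvd (T.norm _) hyd)).trans (Finset.dvd_prod_of_mem _ hγ))

/-- Norms are not additive, so closure under sums needs an outer induction on the order of the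
target L. In the formula for the norm of a + b, terms with proper stabilizer are transfers from
smaller subgroups and fall under the outer hypothesis; the others involve only the norms of a or b
themselves. -/
theorem norm_mem_transferSpan (hX : IsStable X) {H L : Subgroup G} (h : H ≤ L) {x : T.obj H}
    (hx : x ∈ transferSpan X H) : T.norm h x ∈ transferSpan X L := by
  suffices ∀ (n : ℕ) (L : Subgroup G), Nat.card L = n → ∀ {H : Subgroup G} (h : H ≤ L)
      {x : T.obj H}, x ∈ transferSpan X H → T.norm h x ∈ transferSpan X L from
    this _ L rfl h hx
  clear! H L
  intro n
  induction n using Nat.strong_induction_on with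
  | _ n ih =>
  intro L hL H h x hx
  induction hx using transferSpan_induction with
  | zero => rw [T.norm_zero]; exact zero_mem _
  | tr K hK s w hs hsw => exact hX.norm_tr_mem_transferSpan hK h hs hsw
  | add a b ha hb hna hnb =>
    obtain ⟨R, Γ, -, hΓ, hsum⟩ := T.exists_norm_add h a b
    rw [hsum]
    refine sum_mem fun f _ => tr_mem_transferSpan _ ?_
    obtain ⟨γ, hγ⟩ := (hΓ f).nonempty
    refine Ideal.mem_of_dvd _ (Finset.dvd_prod_of_mem _ hγ) ?_
    -- When the stabilizer is all of L, the chosen factor is the norm of a or b up to conjugation by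
    -- an element of L, which acts trivially on T(G/L).
    by_cases hf : stabIn L f = L
    · refine T.norm_res_conj_mem (fun H => transferSpan X H) h hf γ ?_
      cases f (QuotientGroup.mk γ) <;> assumption
    · have hcard : Nat.card (stabIn L f) < n := by
        rw [← hL]
        exact Set.ncard_lt_ncard ((stabIn_le L f).lt_of_ne hf) (Set.toFinite _)
      refine ih _ hcard _ rfl _ (hX.res_mem_transferSpan _ (hX.conj_mem_transferSpan _ _ ?_))
      cases f (QuotientGroup.mk γ) <;> assumption

/-- The Tambara ideal generated by a stable family consists of sums of transfers of multiples. -/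
theorem span_carrier_le (hX : IsStable X) (H : Subgroup G) :
    (span X).carrier H ≤ transferSpan X H := by
  let I : TambaraIdeal T :=
    { carrier := transferSpan X
      res_mem := hX.res_mem_transferSpan
      tr_mem := tr_mem_transferSpan
      norm_mem := hX.norm_mem_transferSpan
      conj_image := conj_image_of_mem _ hX.conj_mem_transferSpan }
  refine (span_le (I := I)).2 (fun H x hx => ?_) H
  have := TambaraIdeal.tr_mem_transferSpan (le_refl H) hx dvd_rfl
  rwa [T.tr_refl] at this

theorem mul (hX : IsStable X) (hY : IsStable Y) : IsStable fun H => X H * Y H where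
  res h x hx := by
    obtain ⟨a, ha, b, hb, rfl⟩ := Set.mem_mul.1 hx
    obtain ⟨c, hc, hca⟩ := hX.res h ha
    obtain ⟨d, hd, hdb⟩ := hY.res h hb
    exact ⟨c * d, Set.mul_mem_mul hc hd, by rw [map_mul]; exact mul_dvd_mul hca hdb⟩
  norm h x hx := by
    obtain ⟨a, ha, b, hb, rfl⟩ := Set.mem_mul.1 hx
    obtain ⟨c, hc, hca⟩ := hX.norm h ha
    obtain ⟨d, hd, hdb⟩ := hY.norm h hb
    exact ⟨c * d, Set.mul_mem_mul hc hd, by rw [map_mul]; exact mul_dvd_mul hca hdb⟩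
  conj g _ _ e x hx := by
    obtain ⟨a, ha, b, hb, rfl⟩ := Set.mem_mul.1 hx
    obtain ⟨c, hc, hca⟩ := hX.conj g e ha
    obtain ⟨d, hd, hdb⟩ := hY.conj g e hb
    exact ⟨c * d, Set.mul_mem_mul hc hd, by rw [map_mul]; exact mul_dvd_mul hca hdb⟩

theorem pow (hX : IsStable X) (n : ℕ) : IsStable fun H => X H ^ n := by
  induction n with
  | zero =>
    refine ⟨fun h x hx => ⟨1, ?_, one_dvd _⟩, fun h x hx => ⟨1, ?_, one_dvd _⟩,
      fun g _ _ e x hx => ⟨1, ?_, one_dvd _⟩⟩ <;> simp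
  | succ n ih =>
    simp only [pow_succ]
    exact ih.mul hX

/-- Frobenius reciprocity twice: t(w) · b = t(w · r(b)), and after expanding r(b) into transfers, w
· t(w') = t(r(w) · w'). Stability of X makes r(w) a multiple of an element of X at the level of w'.
-/
theorem span_mul_span (hX : IsStable X) (hY : IsStable Y) :
    span X * span Y = span fun H => X H * Y H := by
  refine le_antisymm (mul_le.2 fun H a ha b hb => ?_) (span_le.2 fun H => ?_)
  · replace ha := hX.span_carrier_le H ha
    have key : ∀ {K L : Subgroup G} (hL : L ≤ K) {s w : T.obj K} {s' w' : T.obj L}, s ∈ X K →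
        s ∣ w → s' ∈ Y L → s' ∣ w' →
        w * T.tr hL w' ∈ (span fun H => X H * Y H).carrier K := by
      intro K L hL s w s' w' hs hsw hs' hsw'
      rw [← T.frobenius]
      obtain ⟨y, hy, hyd⟩ := hX.res hL hs
      exact (span _).tr_mem _ (Ideal.mem_of_dvd _
        (mul_dvd_mul (hyd.trans (map_dvd (T.res hL) hsw)) hsw')
        (subset_span (fun H => X H * Y H) L (Set.mul_mem_mul hy hs')))
    induction ha using transferSpan_induction with
    | zero => rw [zero_mul]; exact zero_mem _
    | add x y _ _ hx hy => rw [_root_.add_mul]; exact add_mem hx hy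
    | tr K hK s w hs hsw =>
      rw [mul_comm, ← T.frobenius]
      refine (span _).tr_mem _ ?_
      have hb' := hY.span_carrier_le K ((span Y).res_mem hK hb)
      generalize T.res hK b = b' at hb'
      induction hb' using transferSpan_induction with
      | zero => rw [zero_mul]; exact zero_mem _
      | add x y _ _ hx hy => rw [_root_.add_mul]; exact add_mem hx hy
      | tr L hL s' w' hs' hsw' =>
        rw [mul_comm]
        exact key hL hs hsw hs' hsw'
  · rintro x hx
    obtain ⟨a, ha, b, hb, rfl⟩ := Set.mem_mul.1 hx
    exact mul_le.1 le_rfl H a (subset_span X H ha) b (subset_span Y H hb)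

theorem pow_span (hX : IsStable X) (n : ℕ) :
    TambaraIdeal.pow (span X) n = span fun H => X H ^ n := by
  induction n with
  | zero =>
    refine le_antisymm (fun H x _ => ?_) fun H x _ => trivial
    have h1 : (1 : T.obj H) ∈ (span fun H => X H ^ 0).carrier H := subset_span _ _ (by simp)
    simpa using Ideal.mul_mem_left _ x h1
  | succ n ih =>
    change TambaraIdeal.pow (span X) n * span X = _
    rw [ih, (hX.pow n).span_mul_span hX]
    simp only [pow_succ]

end IsStable

/-! ### Finite generation of the powers of a principal ideal -/

/-- The norms of the restrictions of the conjugates of `x`. -/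
def orbitFamily (H₀ : Subgroup G) (x : T.obj H₀) (H : Subgroup G) : Set (T.obj H) :=
  {y | ∃ (K : Subgroup G) (g : G) (h : K ≤ H) (h' : K ≤ MulAut.conj g • H₀),
    y = T.norm h (T.res h' (T.conj g rfl x))}

/-- G has finitely many pairs (K, g). This makes the powers of ⟨x⟩ finitely generated. -/
theorem orbitFamily_finite (H₀ : Subgroup G) (x : T.obj H₀) (H : Subgroup G) :
    (orbitFamily H₀ x H).Finite := by
  refine (Set.finite_range fun p : {p : Subgroup G × G // p.1 ≤ H ∧ p.1 ≤ MulAut.conj p.2 • H₀} =>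
    T.norm p.2.1 (T.res p.2.2 (T.conj p.1.2 rfl x))).subset ?_
  rintro _ ⟨K, g, h, h', rfl⟩
  exact ⟨⟨(K, g), h, h'⟩, rfl⟩

theorem orbitFamily_pow_finite (H₀ : Subgroup G) (x : T.obj H₀) (n : ℕ) (H : Subgroup G) :
    (orbitFamily H₀ x H ^ n).Finite := by
  induction n with
  | zero => exact Set.finite_one
  | succ n ih => rw [pow_succ]; exact ih.mul (orbitFamily_finite H₀ x H)

/-- Norms compose and conjugation passes through norms and restrictions. Restricting a norm gives a
product of several members of the family, by the multiplicative double coset formula; hence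
stability is asked only up to multiples. -/
theorem isStable_orbitFamily (H₀ : Subgroup G) (x : T.obj H₀) : IsStable (orbitFamily H₀ x) where
  res {K H} h y hy := by
    obtain ⟨L, g, hL, hg, rfl⟩ := hy
    obtain ⟨Γ, ⟨γ, hγ⟩, hΓ⟩ := T.exists_res_norm hL h (T.res hg (T.conj g rfl x))
    rw [hΓ]
    refine ⟨_, ⟨K ⊓ MulAut.conj (γ : G) • L, γ * g, inf_le_left,
      inf_le_right.trans (Subgroup.conj_smul_le_conj_mul_smul hg), rfl⟩, ?_⟩
    refine dvd_trans (dvd_of_eq ?_) (Finset.dvd_prod_of_mem _ hγ)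
    rw [T.conj_res_conj _ _ hg rfl (Subgroup.conj_smul_le_conj_mul_smul hg), T.res_res]
  norm h y hy := by
    obtain ⟨L, g, hL, hg, rfl⟩ := hy
    exact ⟨_, ⟨L, g, hL.trans h, hg, T.norm_norm _ _ _⟩, dvd_rfl⟩
  conj γ H H' e y hy := by
    obtain ⟨L, g, hL, hg, rfl⟩ := hy
    have h' : MulAut.conj γ • L ≤ H' := by
      rw [← e]; exact Subgroup.pointwise_smul_le_pointwise_smul_iff.2 hL
    refine ⟨_, ⟨MulAut.conj γ • L, γ * g, h', Subgroup.conj_smul_le_conj_mul_smul hg, ?_⟩, dvd_rfl⟩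
    rw [T.conj_norm γ hL h' rfl e, T.conj_res_conj]

theorem principal_eq_span (H : Subgroup G) (x : T.obj H) :
    principal H x = span (orbitFamily H x) := by
  refine le_antisymm (principal_le.2 (subset_span _ _ ?_)) (span_le.2 fun K y hy => ?_)
  · have e : MulAut.conj (1 : G) • H = H := by simp
    refine ⟨H, 1, le_rfl, e.ge, ?_⟩
    -- The conjugate of H by 1 equals H only propositionally, so the target is generalized before
    -- substituting.
    have key : ∀ (H' : Subgroup G) (e' : MulAut.conj (1 : G) • H = H') (h : H ≤ H'),
        T.res h (T.conj 1 e' x) = x := by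
      intro H' e' h
      obtain rfl : H = H' := e.symm.trans e'
      rw [T.res_refl, T.conj_self _ (one_mem _)]
    rw [T.norm_refl, key]
  · obtain ⟨L, g, hL, hg, rfl⟩ := hy
    exact (principal H x).norm_mem _ ((principal H x).res_mem _
      ((principal H x).conj_mem _ _ (principal_le.1 le_rfl)))

theorem pow_principal (H : Subgroup G) (x : T.obj H) (n : ℕ) :
    pow (principal H x) n = span fun K => orbitFamily H x K ^ n := by
  rw [principal_eq_span, (isStable_orbitFamily H x).pow_span]

/-- This replaces associativity of the product of ideals: multiplication of sets of generators is
associative. -/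
theorem pow_principal_add (H : Subgroup G) (x : T.obj H) (m n : ℕ) :
    pow (principal H x) (m + n) = pow (principal H x) m * pow (principal H x) n := by
  have hX := isStable_orbitFamily H x
  simp only [pow_principal, (hX.pow m).span_mul_span (hX.pow n), pow_add]

/-! ### Existence of primes and the radical as their intersection -/

/-- The union of a nonempty chain of Tambara ideals. -/
def chainUnion (c : Set (TambaraIdeal T)) (hc : IsChain (· ≤ ·) c) (hne : c.Nonempty) :
    TambaraIdeal T where
  carrier H :=
    { carrier := {x | ∃ I ∈ c, x ∈ I.carrier H}
      zero_mem' := hne.imp fun I hI => ⟨hI, zero_mem _⟩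
      add_mem' := by
        rintro x y ⟨I, hI, hx⟩ ⟨J, hJ, hy⟩
        rcases hc.total hI hJ with h | h
        · exact ⟨J, hJ, add_mem (h _ hx) hy⟩
        · exact ⟨I, hI, add_mem hx (h _ hy)⟩
      smul_mem' := fun r _ ⟨I, hI, hx⟩ => ⟨I, hI, Ideal.mul_mem_left _ r hx⟩ }
  res_mem := fun h _ ⟨I, hI, hx⟩ => ⟨I, hI, I.res_mem h hx⟩
  tr_mem := fun h _ ⟨I, hI, hx⟩ => ⟨I, hI, I.tr_mem h hx⟩
  norm_mem := fun h _ ⟨I, hI, hx⟩ => ⟨I, hI, I.norm_mem h hx⟩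
  conj_image := conj_image_of_mem _ fun g _ _ e _ ⟨I, hI, hx⟩ => ⟨I, hI, I.conj_mem g e hx⟩

/-- A Tambara ideal generated by finitely many elements is compact. -/
theorem exists_span_le_of_le_chainUnion {X : ∀ H : Subgroup G, Set (T.obj H)}
    (hX : ∀ H, (X H).Finite) {c : Set (TambaraIdeal T)} (hc : IsChain (· ≤ ·) c)
    (hne : c.Nonempty) (h : span X ≤ chainUnion c hc hne) : ∃ I ∈ c, span X ≤ I := by
  -- The generators of all levels are pooled into one finite set, so that one member of the chain
  -- contains them simultaneously.
  let S : Set (Σ H, T.obj H) := ⋃ H, Sigma.mk H '' X H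
  have hS : S.Finite := Set.finite_iUnion fun H => (hX H).image _
  let F : TambaraIdeal T → Set (Σ H, T.obj H) := fun I => {p | p.2 ∈ I.carrier p.1}
  have hF : DirectedOn (fun I J => F I ⊆ F J) c := fun I hI J hJ => by
    rcases hc.total hI hJ with h | h
    · exact ⟨J, hJ, fun p hp => h _ hp, subset_rfl⟩
    · exact ⟨I, hI, subset_rfl, fun p hp => h _ hp⟩
  obtain ⟨I, hI, hsub⟩ := hF.exists_mem_subset_of_finset_subset_biUnion hne (s := hS.toFinset) (by
    intro p hp
    obtain ⟨H, x, hx, rfl⟩ := Set.mem_iUnion.1 (hS.mem_toFinset.1 hp)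
    obtain ⟨J, hJ, hxJ⟩ := h H (subset_span X H hx)
    exact Set.mem_biUnion hJ hxJ)
  exact ⟨I, hI, span_le.2 fun H x hx =>
    hsub (hS.mem_toFinset.2 (Set.mem_iUnion.2 ⟨H, x, hx, rfl⟩))⟩

/-- If no power of `⟨x⟩` lies in `I`, then some prime containing `I` does not contain `x`. -/
theorem exists_isPrime_notMem {I : TambaraIdeal T} {H : Subgroup G} {x : T.obj H}
    (hx : ∀ n, ¬ pow (principal H x) n ≤ I) :
    ∃ P : TambaraIdeal T, P.IsPrime ∧ I ≤ P ∧ x ∉ P.carrier H := by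
  obtain ⟨P, hIP, hP⟩ := zorn_le_nonempty₀ {J : TambaraIdeal T | ∀ n, ¬ pow (principal H x) n ≤ J}
    (fun c hcs hc y hy => ⟨chainUnion c hc ⟨y, hy⟩, fun n hn => by
      rw [pow_principal] at hn
      obtain ⟨J, hJ, hle⟩ := exists_span_le_of_le_chainUnion
        (orbitFamily_pow_finite H x n) hc ⟨y, hy⟩ hn
      exact hcs hJ n (by rwa [pow_principal]), fun J hJ K z hz => ⟨J, hJ, hz⟩⟩) I hx
  have hPn : ∀ n, ¬ pow (principal H x) n ≤ P := hP.prop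
  -- By maximality, an ideal strictly larger than P contains a power of ⟨x⟩.
  have step : ∀ J : TambaraIdeal T, ¬ J ≤ P → ∃ n, pow (principal H x) n ≤ add P J := by
    intro J hJ
    by_contra! h
    exact hJ ((le_add_right P J).trans (hP.2 h (le_add_left P J)))
  -- Exponent 0 gives properness, since ⟨x⟩⁰ is the unit ideal; exponent 1 gives that x is not in P.
  refine ⟨P, ⟨fun h1 => hPn 0 fun K y _ => ?_, fun J K hJK => ?_⟩, hIP, fun hxP => hPn 1 ?_⟩
  · have := P.res_mem (le_top : K ≤ ⊤) h1
    rw [map_one] at this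
    simpa using Ideal.mul_mem_left _ y this
  · by_contra! hcon
    obtain ⟨m, hm⟩ := step J hcon.1
    obtain ⟨n, hn⟩ := step K hcon.2
    refine hPn (m + n) ?_
    rw [pow_principal_add]
    -- It remains to see (P + J)(P + K) ⊆ P, which holds since JK ⊆ P.
    refine (mul_mono hm hn).trans (mul_le.2 fun L a ha b hb => ?_)
    obtain ⟨p, hp, j, hj, rfl⟩ := Submodule.mem_sup.1 ha
    obtain ⟨q, hq, k, hk, rfl⟩ := Submodule.mem_sup.1 hb
    rw [_root_.add_mul, _root_.mul_add j]
    exact add_mem (Ideal.mul_mem_right _ _ hp)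
      (add_mem (Ideal.mul_mem_left _ _ hq) (mul_le.1 hJK L j hj k hk))
  · exact mul_le.2 fun K a _ b hb => Ideal.mul_mem_left _ a (principal_le.2 hxP K hb)

theorem IsPrime.le_of_pow_le {P I : TambaraIdeal T} (hP : P.IsPrime) {n : ℕ} (h : pow I n ≤ P) :
    I ≤ P := by
  induction n with
  | zero => exact absurd (h ⊤ (x := 1) trivial) hP.1
  | succ n ih => exact (hP.2 _ _ h).elim ih id

/-- The radical of `I` is the intersection of the primes containing `I`. -/
theorem mem_radical_iff {I : TambaraIdeal T} {H : Subgroup G} {x : T.obj H} :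
    x ∈ (radical I).carrier H ↔ ∀ P : TambaraIdeal T, P.IsPrime → I ≤ P → x ∈ P.carrier H := by
  constructor
  · rintro ⟨n, -, hn⟩ P hP hIP
    exact principal_le.1 (hP.le_of_pow_le (hn.trans hIP))
  · intro h
    by_contra hx
    -- The radical only allows exponents n ≥ 1, while exponent 0 must be excluded here too; passing
    -- from n to n + 1 covers it.
    obtain ⟨P, hP, hIP, hxP⟩ := exists_isPrime_notMem (I := I) (x := x) fun n hn =>
      hx ⟨n + 1, by omega, (mul_le_left _ _).trans hn⟩
    exact hxP (h P hP hIP)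

end TambaraIdeal

/-! ### The nilradical and the topology of the spectrum -/

section Nilradical

variable {G : Type*} [Group G] [Finite G] {T : TambaraFunctor G}

theorem TambaraFunctor.mem_nilradical_iff {H : Subgroup G} {x : T.obj H} :
    x ∈ T.nilradical.carrier H ↔ ∀ P : NakaokaSpec T, x ∈ P.1.carrier H := by
  refine TambaraIdeal.mem_radical_iff.trans
    ⟨fun h P => h P.1 P.2 fun K y hy => ?_, fun h P hP _ => h ⟨P, hP⟩⟩
  rw [(hy : y = 0)]
  exact zero_mem _

theorem NakaokaSpec.isOpen_compl_zeroLocus (H : Subgroup G) (x : T.obj H) :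
    IsOpen {P : NakaokaSpec T | x ∉ P.1.carrier H} :=
  TopologicalSpace.isOpen_generateFrom_of_mem ⟨H, x, rfl⟩

/-- A smaller prime belongs to every open set that contains a larger one. -/
theorem NakaokaSpec.mem_of_isOpen_of_le {P Q : NakaokaSpec T} (h : Q.1 ≤ P.1)
    {U : Set (NakaokaSpec T)} (hU : IsOpen U) (hP : P ∈ U) : Q ∈ U := by
  induction hU with
  | basic U hU =>
    obtain ⟨H, x, rfl⟩ := hU
    exact fun hx => hP (h H hx)
  | univ => trivial
  | inter U V _ _ ihU ihV => exact ⟨ihU hP.1, ihV hP.2⟩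
  | sUnion S _ ih =>
    obtain ⟨U, hU, hPU⟩ := hP
    exact ⟨U, hU, ih U hU hPU⟩

end Nilradical

theorem mainTheorem12 {G : Type*} [Group G] [Finite G] (T : TambaraFunctor G) (hT : ¬ T.IsZero) :
    T.nilradical.IsPrime ↔ IrreducibleSpace (NakaokaSpec T) := by
  constructor
  · intro h
    -- The nilradical is the generic point.
    let N : NakaokaSpec T := ⟨T.nilradical, h⟩
    have hN : ∀ {U : Set (NakaokaSpec T)}, IsOpen U → U.Nonempty → N ∈ U := fun hU ⟨P, hP⟩ =>
      NakaokaSpec.mem_of_isOpen_of_le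
        (fun _ _ hx => TambaraFunctor.mem_nilradical_iff.1 hx P) hU hP
    have : PreirreducibleSpace (NakaokaSpec T) :=
      .of_forall_nonempty_inter fun U V hU hV hU' hV' => ⟨N, hN hU hU', hN hV hV'⟩
    exact { toNonempty := ⟨N⟩ }
  · intro h
    obtain ⟨P₀⟩ := h.toNonempty
    refine ⟨fun h1 => P₀.2.1 (TambaraFunctor.mem_nilradical_iff.1 h1 P₀), fun I J hIJ => ?_⟩
    by_contra! hcon
    -- An ideal outside the intersection of all primes has an element missed by some prime, which
    -- yields a nonempty subbasic open set.
    have missed : ∀ I : TambaraIdeal T, ¬ I ≤ T.nilradical →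
        ∃ (H : Subgroup G) (x : T.obj H), x ∈ I.carrier H ∧
          {P : NakaokaSpec T | x ∉ P.1.carrier H}.Nonempty := by
      intro I hI
      by_contra! hall
      refine hI fun H x hx => TambaraFunctor.mem_nilradical_iff.2 fun P => ?_
      by_contra hxP
      exact (Set.eq_empty_iff_forall_notMem.1 (hall H x hx) P) hxP
    obtain ⟨H, x, hx, hxne⟩ := missed I hcon.1
    obtain ⟨K, y, hy, hyne⟩ := missed J hcon.2
    obtain ⟨P, hxP, hyP⟩ := nonempty_preirreducible_inter
      (NakaokaSpec.isOpen_compl_zeroLocus H x) (NakaokaSpec.isOpen_compl_zeroLocus K y) hxne hyne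
    rcases P.2.2 I J (hIJ.trans fun _ _ hz => TambaraFunctor.mem_nilradical_iff.1 hz P) with h | h
    · exact hxP (h H hx)
    · exact hyP (h K hy)
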